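/- Let $\Bbbk=\mathbb F_3[t_1,t_2,t_3,t_4]/(t_1^2,t_2^2,t_3^2,t_4^2)$, let $$M=\Bbbk^4/\langle t_1e_1+t_2e_2+t_3e_3+t_4e_4\rangle ,$$ where $e_1,\dots,e_4$ is the standard basis of $\Bbbk^4$, and let $\mathfrak g=\mathcal F(M)$ be the free Lie algebra on the $\Bbbk$-module $M$, where $\mathcal F$ is the left adjoint of the forgetful functor $\mathcal U$ from Lie algebras over $\Bbbk$ to $\Bbbk$-modules. Then $$H_3^{\sf CE}(\mathfrak g)\neq 0 \qquad\text{and}\qquad H_3^{\sf RS}(\mathfrak g)=0 .$$ Here, for a Lie algebra $\mathfrak h$ over $\Bbbk$, the Chevalley–Eilenberg homology $H_n^{\sf CE}(\mathfrak h)$ is the $n$-th homology of the complex with components $\Lambda^n_{\Bbbk}\mathfrak h$ and differential $$\partial(x_1\wedge\dots\wedge x_n)=\sum_{i<j}(-1)^{i+j}[x_i,x_j]\wedge x_1\wedge\dots\wedge\hat x_i\wedge\dots\wedge\hat x_j\wedge\dots\wedge x_n .$$ The relative simplicial homology is $H^{\sf RS}_{n+1}(\mathfrak h)=L_n^{\mathcal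 G}{\sf ab}(\mathfrak h)$ for $n\ge 0$, the comonad derived functors of the abelianization functor ${\sf ab}(\mathfrak h)=\mathfrak h/[\mathfrak h,\mathfrak h]$ with respect to the comonad $(\mathcal G=\mathcal F\,\mathcal U,\varepsilon,\delta)$ of this adjunction. That is, $L_n^{\mathcal G}{\sf ab}(\mathfrak h)$ is the $n$-th homology of the complex with components ${\sf ab}(\mathcal G^{n+1}\mathfrak h)$, $n\ge 0$, and differential $\sum_{i=0}^n(-1)^i\,{\sf ab}(\mathcal G^i\varepsilon\mathcal G^{n-i})$. -/

import Mathlib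

open CategoryTheory

universe u

noncomputable section

/-! ## The category of Lie algebras -/

/-- A bundled Lie algebra over the commutative ring `R`. -/
structure LieAlgCat (R : Type u) [CommRing R] where
  carrier : Type u
  [lieRing : LieRing carrier]
  [lieAlgebra : LieAlgebra R carrier]

namespace LieAlgCat

variable (R : Type u) [CommRing R]

instance : CoeSort (LieAlgCat R) (Type u) := ⟨LieAlgCat.carrier⟩

attribute [instance] LieAlgCat.lieRing LieAlgCat.lieAlgebra

/-- The bundled Lie algebra on an unbundled one. -/
abbrev of (L : Type u) [LieRing L] [LieAlgebra R L] : LieAlgCat R := ⟨L⟩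

/-- A morphism of Lie algebras is an `R`-linear map that preserves the bracket. -/
@[ext]
structure Hom (A B : LieAlgCat R) where
  hom : A →ₗ⁅R⁆ B

instance : Category (LieAlgCat R) where
  Hom A B := Hom R A B
  id A := ⟨LieHom.id⟩
  comp f g := ⟨g.hom.comp f.hom⟩

@[simp] theorem id_hom (A : LieAlgCat R) : Hom.hom (𝟙 A) = LieHom.id := rfl

@[simp] theorem comp_hom {A B C : LieAlgCat R} (f : A ⟶ B) (g : B ⟶ C) :
    Hom.hom (f ≫ g) = (Hom.hom g).comp (Hom.hom f) := rfl

/-- The forgetful functor from Lie algebras to modules. -/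
def toModule : LieAlgCat R ⥤ ModuleCat.{u} R where
  obj A := ModuleCat.of R A
  map f := ModuleCat.ofHom (Hom.hom f : _ →ₗ[R] _)

/-- The derived ideal `[L, L]`, as a submodule of `L`. -/
abbrev derived (L : Type u) [LieRing L] [LieAlgebra R L] : Submodule R L :=
  (⁅(⊤ : LieIdeal R L), (⊤ : LieIdeal R L)⁆ : LieIdeal R L).toSubmodule

theorem derived_le_comap {L L' : Type u} [LieRing L] [LieAlgebra R L] [LieRing L']
    [LieAlgebra R L'] (f : L →ₗ⁅R⁆ L') :
    derived R L ≤ (derived R L').comap (f : L →ₗ[R] L') := by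
  rw [derived, LieSubmodule.lieIdeal_oper_eq_linear_span', Submodule.span_le]
  rintro _ ⟨x, -, y, -, rfl⟩
  have h : ⁅f x, f y⁆ ∈ (⁅(⊤ : LieIdeal R L'), (⊤ : LieIdeal R L')⁆ : LieIdeal R L') :=
    LieSubmodule.lie_mem_lie (LieSubmodule.mem_top _) (LieSubmodule.mem_top _)
  simpa using h

/-- The abelianization functor `L ↦ L / [L, L]` from Lie algebras to modules. -/
def ab : LieAlgCat R ⥤ ModuleCat.{u} R where
  obj A := ModuleCat.of R (A ⧸ derived R A)
  map {A B} f := ModuleCat.ofHom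
    (Submodule.mapQ (derived R A) (derived R B) (Hom.hom f : A →ₗ[R] B)
      (derived_le_comap R (Hom.hom f)))
  map_id A := by
    ext x
    rfl
  map_comp f g := by
    ext x
    rfl

end LieAlgCat

/-! ## The free Lie algebra on a module -/

section FreeLie

variable (R : Type u) [CommRing R] (M : Type u) [AddCommGroup M] [Module R M]

/-- The relations that make the canonical map `M → FreeLieAlgebra R M` linear. -/
def moduleFreeLieIdeal : LieIdeal R (FreeLieAlgebra R M) :=
  LieSubmodule.lieSpan R (FreeLieAlgebra R M)
    ({z | ∃ x y : M, z = FreeLieAlgebra.of R (x + y) -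
        (FreeLieAlgebra.of R x + FreeLieAlgebra.of R y)} ∪
      {z | ∃ (r : R) (x : M), z = FreeLieAlgebra.of R (r • x) - r • FreeLieAlgebra.of R x})

/-- The free Lie algebra `ℱ(M)` on the module `M`: the free Lie algebra on the set `M`, modulo the
ideal that makes the inclusion of `M` linear. -/
abbrev ModuleFreeLie : Type u := FreeLieAlgebra R M ⧸ moduleFreeLieIdeal R M

namespace ModuleFreeLie

/-- The canonical linear map `M → ℱ(M)`. -/
def of : M →ₗ[R] ModuleFreeLie R M where
  toFun x := LieSubmodule.Quotient.mk (FreeLieAlgebra.of R x)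
  map_add' x y := by
    refine (Submodule.Quotient.eq _).2 (LieSubmodule.subset_lieSpan (Or.inl ⟨x, y, rfl⟩))
  map_smul' r x := by
    refine (Submodule.Quotient.eq _).2 (LieSubmodule.subset_lieSpan (Or.inr ⟨r, x, rfl⟩))

variable {M} {L : Type u} [LieRing L] [LieAlgebra R L]

theorem ideal_le_ker (f : M →ₗ[R] L) :
    moduleFreeLieIdeal R M ≤ (FreeLieAlgebra.lift R (f : M → L)).ker := by
  refine LieSubmodule.lieSpan_le.2 ?_
  rintro z (⟨x, y, rfl⟩ | ⟨r, x, rfl⟩) <;> simp [LieHom.mem_ker]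

/-- The extension of a linear map `M → L` to a morphism of Lie algebras `ℱ(M) → L`. -/
def lift (f : M →ₗ[R] L) : ModuleFreeLie R M →ₗ⁅R⁆ L :=
  { Submodule.liftQ (moduleFreeLieIdeal R M).toSubmodule
      (FreeLieAlgebra.lift R (f : M → L) : FreeLieAlgebra R M →ₗ[R] L)
      (fun _ hx => ideal_le_ker R f hx) with
    map_lie' := by
      intro x y
      induction x using Submodule.Quotient.induction_on
      induction y using Submodule.Quotient.induction_on
      exact LieHom.map_lie (FreeLieAlgebra.lift R (f : M → L)) _ _ }

@[simp] theorem lift_of (f : M →ₗ[R] L) (x : M) : lift R f (of R M x) = f x :=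
  FreeLieAlgebra.lift_of_apply (f : M → L) x

/-- The restriction of a morphism `ℱ(M) → L` to the generators. -/
def restrict (g : ModuleFreeLie R M →ₗ⁅R⁆ L) : M →ₗ[R] L :=
  (g : ModuleFreeLie R M →ₗ[R] L) ∘ₗ of R M

variable {R} in
theorem hom_ext {f g : ModuleFreeLie R M →ₗ⁅R⁆ L} (h : ∀ x, f (of R M x) = g (of R M x)) :
    f = g := by
  let q : FreeLieAlgebra R M →ₗ⁅R⁆ ModuleFreeLie R M :=
    { (moduleFreeLieIdeal R M).toSubmodule.mkQ with map_lie' := rfl }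
  have hq : f.comp q = g.comp q := FreeLieAlgebra.hom_ext h
  ext x
  induction x using Submodule.Quotient.induction_on with
  | H x => exact LieHom.congr_fun hq x

end ModuleFreeLie

/-- The free Lie algebra functor from modules to Lie algebras. -/
def freeLie : ModuleCat.{u} R ⥤ LieAlgCat R where
  obj M := LieAlgCat.of R (ModuleFreeLie R M)
  map {M N} f := ⟨ModuleFreeLie.lift R (ModuleFreeLie.of R N ∘ₗ f.hom)⟩
  map_id M := LieAlgCat.Hom.ext (ModuleFreeLie.hom_ext fun x => by simp)
  map_comp f g := LieAlgCat.Hom.ext (ModuleFreeLie.hom_ext fun x => by simp)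

/-- The free-forgetful adjunction between modules and Lie algebras: the morphism `f : ℱ(M) ⟶ A`
corresponds to its restriction `M ⟶ A` to the generators. -/
def freeLieAdj : freeLie R ⊣ LieAlgCat.toModule R :=
  Adjunction.mkOfHomEquiv
    { homEquiv := fun M A =>
        { toFun := fun (f : (freeLie R).obj M ⟶ A) =>
            ModuleCat.ofHom (ModuleFreeLie.restrict R (L := A) (LieAlgCat.Hom.hom f))
          invFun := fun (f : M ⟶ ModuleCat.of R A) =>
            ⟨ModuleFreeLie.lift R (f.hom : M →ₗ[R] A)⟩
          left_inv := fun (f : (freeLie R).obj M ⟶ A) =>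
            LieAlgCat.Hom.ext (ModuleFreeLie.hom_ext fun x => ModuleFreeLie.lift_of R _ x)
          right_inv := fun (f : M ⟶ ModuleCat.of R A) => by
            ext x
            exact ModuleFreeLie.lift_of R (f.hom : M →ₗ[R] A) x }
      homEquiv_naturality_left_symm := fun {M' M A} f (g : M ⟶ ModuleCat.of R A) =>
        LieAlgCat.Hom.ext (ModuleFreeLie.hom_ext fun x => by
          refine (ModuleFreeLie.lift_of R ((g.hom : M →ₗ[R] A) ∘ₗ f.hom) x).trans ?_
          change _ = ModuleFreeLie.lift R (g.hom : M →ₗ[R] A)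
            (ModuleFreeLie.lift R (ModuleFreeLie.of R M ∘ₗ f.hom) (ModuleFreeLie.of R M' x))
          rw [ModuleFreeLie.lift_of, LinearMap.comp_apply, LinearMap.comp_apply,
            ModuleFreeLie.lift_of])
      homEquiv_naturality_right := fun f g => by
        ext x
        rfl }

end FreeLie

/-! ## Comonad derived functors -/

namespace ComonadBar

variable {C : Type*} [Category C] (G : Comonad C)

/-- The iterate `Gⁿ X`. -/
def pow (X : C) : ℕ → C
  | 0 => X
  | n + 1 => (G : C ⥤ C).obj (pow X n)

/-- The face `d_i = Gⁱ ε Gⁿ⁻ⁱ : Gⁿ⁺¹ X ⟶ Gⁿ X` of the bar construction, for `0 ≤ i ≤ n`. -/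
def face (X : C) : (n : ℕ) → Fin (n + 1) → (pow G X (n + 1) ⟶ pow G X n)
  | n, ⟨0, _⟩ => G.ε.app (pow G X n)
  | n + 1, ⟨i + 1, h⟩ => (G : C ⥤ C).map (face X n ⟨i, Nat.lt_of_succ_lt_succ h⟩)

@[simp] theorem face_zero (X : C) (n : ℕ) : face G X n 0 = G.ε.app (pow G X n) := by
  cases n <;> rfl

@[simp] theorem face_succ (X : C) (n : ℕ) (i : Fin (n + 1)) :
    face G X (n + 1) i.succ = (G : C ⥤ C).map (face G X n i) := rfl

/-- The simplicial identity `d_i d_{j+1} = d_j d_i` for `i ≤ j` (compositions written from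
right to left). -/
theorem face_comp_face (X : C) : ∀ (n : ℕ) (i j : Fin (n + 1)), i ≤ j →
    face G X (n + 1) j.succ ≫ face G X n i = face G X (n + 1) i.castSucc ≫ face G X n j := by
  intro n
  induction n with
  | zero =>
    intro i j _
    obtain rfl : i = 0 := Fin.fin_one_eq_zero i
    obtain rfl : j = 0 := Fin.fin_one_eq_zero j
    exact G.ε.naturality _
  | succ n ih =>
    intro i j hij
    induction i using Fin.cases with
    | zero =>
      rw [face_succ, face_zero, Fin.castSucc_zero, face_zero]
      exact G.ε.naturality _
    | succ i =>
      induction j using Fin.cases with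
      | zero => exact absurd hij (by simp)
      | succ j =>
        have h := congrArg (G : C ⥤ C).map (ih i j (Fin.succ_le_succ_iff.1 hij))
        rw [Functor.map_comp, Functor.map_comp] at h
        exact h

variable {A : Type*} [Category A] [Preadditive A] (Φ : C ⥤ A)

/-- The alternating sum of the faces of `Φ(Bar(G)(X))`. -/
def d (X : C) (n : ℕ) : Φ.obj (pow G X (n + 2)) ⟶ Φ.obj (pow G X (n + 1)) :=
  ∑ i : Fin (n + 2), (-1 : ℤ) ^ (i : ℕ) • Φ.map (face G X (n + 1) i)

theorem d_comp_d (X : C) (n : ℕ) : d G Φ X (n + 1) ≫ d G Φ X n = 0 := by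
  simp only [d, Preadditive.comp_sum, Preadditive.sum_comp, ← Finset.sum_product']
  let P := Fin (n + 2) × Fin (n + 3)
  let S : Finset P := {ij : P | (ij.2 : ℕ) ≤ (ij.1 : ℕ)}
  rw [Finset.univ_product_univ, ← Finset.sum_add_sum_compl S, ← eq_neg_iff_add_eq_zero,
    ← Finset.sum_neg_distrib]
  let φ : ∀ ij : P, ij ∈ S → P := fun ij hij =>
    (Fin.castLT ij.2 (lt_of_le_of_lt (Finset.mem_filter.mp hij).right (Fin.is_lt ij.1)), ij.1.succ)
  apply Finset.sum_bij φ
  · intro ij hij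
    simp_rw [S, φ, Finset.compl_filter, Finset.mem_filter_univ, Fin.val_succ,
      Fin.val_castLT] at hij ⊢
    lia
  · rintro ⟨i, j⟩ hij ⟨i', j'⟩ hij' h
    rw [Prod.mk_inj]
    exact ⟨by simpa [φ] using! congr_arg Prod.snd h,
      by simpa [φ, Fin.castSucc_castLT] using! congr_arg Fin.castSucc (congr_arg Prod.fst h)⟩
  · rintro ⟨i', j'⟩ hij'
    simp_rw [S, Finset.compl_filter, Finset.mem_filter_univ, not_le] at hij'
    refine ⟨(j'.pred <| ?_, Fin.castSucc i'), ?_, ?_⟩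
    · rintro rfl
      simp only [Fin.val_zero, not_lt_zero] at hij'
    · simpa [S] using! Nat.le_sub_one_of_lt hij'
    · simp only [φ, Fin.castLT_castSucc, Fin.succ_pred]
  · rintro ⟨i, j⟩ hij
    have hle : (j : ℕ) ≤ (i : ℕ) := (Finset.mem_filter.mp hij).right
    have key := face_comp_face G X (n + 1)
      (Fin.castLT j (lt_of_le_of_lt hle (Fin.is_lt i))) i hle
    rw [Fin.castSucc_castLT] at key
    dsimp only [φ]
    simp only [Preadditive.zsmul_comp, Preadditive.comp_zsmul, smul_smul, ← neg_smul,
      ← Functor.map_comp, key]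
    congr 1
    simp only [Fin.val_succ, Fin.val_castLT, pow_add, pow_one, mul_neg, neg_neg, mul_one]
    apply mul_comm

/-- The chain complex of the simplicial object `Φ(Bar(G)(X))`: it is `Φ(Gⁿ⁺¹ X)` in degree `n`, and
its differential is the alternating sum of the faces. -/
def complex (X : C) : ChainComplex A ℕ :=
  ChainComplex.of (fun n => Φ.obj (pow G X (n + 1))) (d G Φ X) (d_comp_d G Φ X)

end ComonadBar

/-- The comonad derived functor `L_n^G Φ`, evaluated at `X`. -/
def comonadDerived {C : Type*} [Category C] {A : Type*} [Category A] [Abelian A]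
    (G : Comonad C) (Φ : C ⥤ A) (n : ℕ) (X : C) : A :=
  (ComonadBar.complex G Φ X).homology n

/-- The relative simplicial homology `H^RS_n(L) = L_{n-1} ab (L)`, for `n ≥ 1`, where the derived
functors are taken with respect to the comonad of the adjunction between modules and Lie
algebras. -/
def relSimplicialHomology (R : Type u) [CommRing R] (L : LieAlgCat R) (n : ℕ) [NeZero n] :
    ModuleCat.{u} R :=
  comonadDerived (freeLieAdj R).toComonad (LieAlgCat.ab R) (n - 1) L

/-! ## The Chevalley-Eilenberg complex -/

namespace ChevalleyEilenberg

open ExteriorAlgebra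

variable (R : Type u) [CommRing R] (L : Type u) [LieRing L] [LieAlgebra R L]

variable {L} in
/-- The recursion step for the action of `x` on the exterior algebra:
`x · (m ∧ ω) = [x, m] ∧ ω + m ∧ (x · ω)`. -/
def actStep (x : L) : L →ₗ[R] ExteriorAlgebra R L × ExteriorAlgebra R L →ₗ[R]
    ExteriorAlgebra R L :=
  ((LinearMap.mul R (ExteriorAlgebra R L)) ∘ₗ ι R ∘ₗ (LieAlgebra.ad R L x)).compl₂
      (LinearMap.fst R _ _) +
    ((LinearMap.mul R (ExteriorAlgebra R L)) ∘ₗ ι R).compl₂ (LinearMap.snd R _ _)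

variable {L} in
theorem actStep_apply (x m : L) (a b : ExteriorAlgebra R L) :
    actStep R x m (a, b) = ι R ⁅x, m⁆ * a + ι R m * b := rfl

variable {L} in
theorem actStep_actStep (x m : L) (a b : ExteriorAlgebra R L) :
    actStep R x m (ι R m * a, actStep R x m (a, b)) = (0 : QuadraticForm R L) m • b := by
  have h1 : ι R m * (ι R m * b) = 0 := by rw [← mul_assoc, ι_sq_zero, zero_mul]
  have h2 : ι R ⁅x, m⁆ * (ι R m * a) + ι R m * (ι R ⁅x, m⁆ * a) = 0 := by
    rw [← mul_assoc, ← mul_assoc, ← add_mul, ι_add_mul_swap, zero_mul]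
  rw [actStep_apply, actStep_apply, mul_add, h1, add_zero, h2]
  simp

variable {L} in
/-- The action of `x` on the exterior algebra: the derivation that extends `y ↦ [x, y]`. -/
def act (x : L) : ExteriorAlgebra R L →ₗ[R] ExteriorAlgebra R L :=
  CliffordAlgebra.foldr' 0 (actStep R x) (actStep_actStep R x) 0

variable {R L}

theorem act_algebraMap (x : L) (r : R) : act R x (algebraMap R _ r) = 0 := by
  have h := CliffordAlgebra.foldr'_algebraMap (Q := (0 : QuadraticForm R L)) (actStep R x)
    (actStep_actStep R x) 0 r
  rw [smul_zero] at h
  exact h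

theorem act_ι_mul (x m : L) (w : ExteriorAlgebra R L) :
    act R x (ι R m * w) = ι R ⁅x, m⁆ * w + ι R m * act R x w :=
  CliffordAlgebra.foldr'_ι_mul (Q := (0 : QuadraticForm R L)) (actStep R x)
    (actStep_actStep R x) 0 m w

theorem ext_induction {P : ExteriorAlgebra R L → Prop} (h0 : ∀ r : R, P (algebraMap R _ r))
    (hadd : ∀ x y, P x → P y → P (x + y)) (hmul : ∀ (m : L) x, P x → P (ι R m * x)) (x) : P x :=
  CliffordAlgebra.left_induction (Q := (0 : QuadraticForm R L)) h0 hadd (fun x m => hmul m x) x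

theorem act_add_left (x y : L) (w : ExteriorAlgebra R L) :
    act R (x + y) w = act R x w + act R y w := by
  induction w using ext_induction with
  | h0 r => simp [act_algebraMap]
  | hadd a b ha hb => rw [map_add, map_add, map_add, ha, hb]; abel
  | hmul m a ha =>
    rw [act_ι_mul, act_ι_mul, act_ι_mul, ha, add_lie, map_add, add_mul, mul_add]; abel

theorem act_smul_left (r : R) (x : L) (w : ExteriorAlgebra R L) :
    act R (r • x) w = r • act R x w := by
  induction w using ext_induction with
  | h0 r => simp [act_algebraMap]
  | hadd a b ha hb => rw [map_add, map_add, ha, hb, smul_add]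
  | hmul m a ha =>
    rw [act_ι_mul, act_ι_mul, ha, smul_lie, map_smul, smul_add, smul_mul_assoc, mul_smul_comm]

theorem act_lie (x y : L) (w : ExteriorAlgebra R L) :
    act R ⁅x, y⁆ w = act R x (act R y w) - act R y (act R x w) := by
  induction w using ext_induction with
  | h0 r => simp [act_algebraMap]
  | hadd a b ha hb => simp only [map_add, ha, hb]; abel
  | hmul m a ha =>
    simp only [act_ι_mul, map_add, ha, lie_lie, map_sub, sub_mul, mul_sub]; abel

variable (R L)

/-- The recursion step for the differential: `∂(m ∧ ω) = - m · ω - m ∧ ∂ω`. -/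
def bdStep : L →ₗ[R] ExteriorAlgebra R L × ExteriorAlgebra R L →ₗ[R] ExteriorAlgebra R L :=
  -((LinearMap.mk₂ R (fun (x : L) w => act R x w) act_add_left act_smul_left
      (fun _ => map_add _) (fun r _ => map_smul _ r)).compl₂ (LinearMap.fst R _ _)) -
    ((LinearMap.mul R (ExteriorAlgebra R L)) ∘ₗ ι R).compl₂ (LinearMap.snd R _ _)

variable {L} in
theorem bdStep_apply (m : L) (a b : ExteriorAlgebra R L) :
    bdStep R L m (a, b) = -act R m a - ι R m * b := rfl

variable {L} in
theorem bdStep_bdStep (m : L) (a b : ExteriorAlgebra R L) :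
    bdStep R L m (ι R m * a, bdStep R L m (a, b)) = (0 : QuadraticForm R L) m • b := by
  have h1 : ι R m * (ι R m * b) = 0 := by rw [← mul_assoc, ι_sq_zero, zero_mul]
  rw [bdStep_apply, bdStep_apply, act_ι_mul, lie_self, mul_sub, h1]
  simp

/-- The Chevalley-Eilenberg differential on the exterior algebra; `bd_ιMulti` below is its closed
formula. -/
def bd : ExteriorAlgebra R L →ₗ[R] ExteriorAlgebra R L :=
  CliffordAlgebra.foldr' 0 (bdStep R L) (bdStep_bdStep R) 0

variable {R L}

theorem bd_algebraMap (r : R) : bd R L (algebraMap R _ r) = 0 := by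
  have h := CliffordAlgebra.foldr'_algebraMap (Q := (0 : QuadraticForm R L)) (bdStep R L)
    (bdStep_bdStep R) 0 r
  rw [smul_zero] at h
  exact h

theorem bd_ι_mul (m : L) (w : ExteriorAlgebra R L) :
    bd R L (ι R m * w) = -act R m w - ι R m * bd R L w :=
  CliffordAlgebra.foldr'_ι_mul (Q := (0 : QuadraticForm R L)) (bdStep R L)
    (bdStep_bdStep R) 0 m w

theorem bd_act (x : L) (w : ExteriorAlgebra R L) :
    bd R L (act R x w) = act R x (bd R L w) := by
  induction w using ext_induction with
  | h0 r => simp [act_algebraMap, bd_algebraMap]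
  | hadd a b ha hb => rw [map_add, map_add, map_add, map_add, ha, hb]
  | hmul m a ha =>
    simp only [act_ι_mul, bd_ι_mul, map_add, map_sub, map_neg, ha, act_lie]; abel

theorem bd_bd (w : ExteriorAlgebra R L) : bd R L (bd R L w) = 0 := by
  induction w using ext_induction with
  | h0 r => simp [bd_algebraMap]
  | hadd a b ha hb => rw [map_add, map_add, ha, hb, add_zero]
  | hmul m a ha =>
    rw [bd_ι_mul, map_sub, map_neg, bd_act, bd_ι_mul, ha]
    simp

theorem act_ιMulti (x : L) : ∀ {n : ℕ} (v : Fin (n + 1) → L),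
    act R x (ιMulti R (n + 1) v) = ∑ j : Fin (n + 1), (-1 : R) ^ (j : ℕ) •
      (ι R ⁅x, v j⁆ * ιMulti R n (fun k => v (j.succAbove k)))
  | 0, v => by
    have h := act_algebraMap (R := R) x 1
    rw [map_one] at h
    rw [ιMulti_succ_apply, act_ι_mul, ιMulti_zero_apply, h]
    simp
  | n + 1, v => by
    have hsw : ∀ a b : L, ι R a * ι R b = -(ι R b * ι R a) := fun a b =>
      eq_neg_of_add_eq_zero_left (ι_add_mul_swap a b)
    rw [ιMulti_succ_apply, act_ι_mul, act_ιMulti x (Matrix.vecTail v), Finset.mul_sum,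
      Fin.sum_univ_succ (n := n + 1)]
    congr 1
    · simp [Matrix.vecTail, Function.comp_def]
    · refine Finset.sum_congr rfl fun j _ => ?_
      rw [ιMulti_succ_apply, mul_smul_comm, ← mul_assoc, ← mul_assoc, hsw (v 0)]
      simp [Matrix.vecTail, Function.comp_def, pow_succ]

/-- The closed formula
`∂(x₁ ∧ ⋯ ∧ xₙ) = ∑_{i < j} (-1)^{i+j} [x_i, x_j] ∧ x₁ ∧ ⋯ x̂_i ⋯ x̂_j ⋯ ∧ xₙ`. The pairs are written
as `i.castSucc < j.succ`, which means `i ≤ j`. -/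
theorem bd_ιMulti : ∀ {n : ℕ} (v : Fin (n + 2) → L),
    bd R L (ιMulti R (n + 2) v) = ∑ i : Fin (n + 1), ∑ j : Fin (n + 1),
      if i ≤ j then (-1 : R) ^ ((i.castSucc : ℕ) + (j.succ : ℕ)) •
        (ι R ⁅v i.castSucc, v j.succ⁆ * ιMulti R n (fun k => v (j.succ.succAbove (i.succAbove k))))
      else 0
  | 0, v => by
    have h := act_algebraMap (R := R) (Matrix.vecTail v 0) 1
    have h' := act_algebraMap (R := R) (v 0) 1
    have h'' := bd_algebraMap (R := R) (L := L) 1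
    rw [map_one] at h h' h''
    have e := ιMulti_succ_apply (R := R) (n := 0) (Matrix.vecTail v)
    rw [ιMulti_succ_apply, e, bd_ι_mul, act_ι_mul, bd_ι_mul, ιMulti_zero_apply, h, h', h'']
    simp [Matrix.vecTail]
  | n + 1, v => by
    have hsw : ∀ a b : L, ι R a * ι R b = -(ι R b * ι R a) := fun a b =>
      eq_neg_of_add_eq_zero_left (ι_add_mul_swap a b)
    rw [ιMulti_succ_apply, bd_ι_mul, bd_ιMulti (Matrix.vecTail v),
      act_ιMulti (v 0) (Matrix.vecTail v), sub_eq_add_neg]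
    refine Eq.trans ?_ (Fin.sum_univ_succ (n := n + 1) _).symm
    congr 1
    · rw [← Finset.sum_neg_distrib]
      refine Finset.sum_congr rfl fun j _ => ?_
      simp [Matrix.vecTail, Function.comp_def, pow_succ]
    · rw [Finset.mul_sum, ← Finset.sum_neg_distrib]
      refine Finset.sum_congr rfl fun i _ => ?_
      refine Eq.trans ?_ (Fin.sum_univ_succ (n := n + 1) _).symm
      rw [Finset.mul_sum, ← Finset.sum_neg_distrib]
      rw [if_neg (by simp), zero_add]
      refine Finset.sum_congr rfl fun j _ => ?_
      by_cases hij : i ≤ j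
      · rw [if_pos hij, if_pos (Fin.succ_le_succ_iff.2 hij), ιMulti_succ_apply, mul_smul_comm,
          ← mul_assoc, ← mul_assoc, hsw (v 0)]
        simp [Matrix.vecTail, Function.comp_def, pow_succ, pow_add]
      · rw [if_neg hij, if_neg (fun h => hij (Fin.succ_le_succ_iff.1 h))]
        simp

theorem act_mem (x : L) : ∀ (n : ℕ) {w : ExteriorAlgebra R L}, w ∈ ⋀[R]^n L →
    act R x w ∈ ⋀[R]^n L
  | 0, w, hw => by
    rw [exteriorPower, pow_zero] at hw
    obtain ⟨r, rfl⟩ := Submodule.mem_one.1 hw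
    rw [act_algebraMap]
    exact zero_mem _
  | n + 1, w, hw => by
    rw [exteriorPower, pow_succ'] at hw
    induction hw using Submodule.mul_induction_on' with
    | mem_mul_mem a ha b hb =>
      obtain ⟨m, rfl⟩ := ha
      rw [act_ι_mul, exteriorPower, pow_succ']
      exact add_mem (Submodule.mul_mem_mul ⟨_, rfl⟩ hb)
        (Submodule.mul_mem_mul ⟨_, rfl⟩ (act_mem x n hb))
    | add a _ b _ ha hb => rw [map_add]; exact add_mem ha hb

theorem bd_mem : ∀ (n : ℕ) {w : ExteriorAlgebra R L}, w ∈ ⋀[R]^(n + 1) L →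
    bd R L w ∈ ⋀[R]^n L := by
  intro n w hw
  rw [exteriorPower, pow_succ'] at hw
  induction hw using Submodule.mul_induction_on' with
  | mem_mul_mem a ha b hb =>
    obtain ⟨m, rfl⟩ := ha
    rw [bd_ι_mul]
    refine sub_mem (neg_mem (act_mem m n hb)) ?_
    cases n with
    | zero =>
      rw [pow_zero] at hb
      obtain ⟨r, rfl⟩ := Submodule.mem_one.1 hb
      rw [bd_algebraMap, mul_zero]
      exact zero_mem _
    | succ n =>
      have h := bd_mem n hb
      rw [exteriorPower, pow_succ']
      exact Submodule.mul_mem_mul ⟨_, rfl⟩ h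
  | add a _ b _ ha hb => rw [map_add]; exact add_mem ha hb

variable (R L)

/-- The Chevalley-Eilenberg differential `Λⁿ⁺¹ L → Λⁿ L`. -/
def d (n : ℕ) : ⋀[R]^(n + 1) L →ₗ[R] ⋀[R]^n L :=
  (bd R L).restrict fun _ hw => bd_mem n hw

/-- The Chevalley-Eilenberg complex, which is `Λⁿ L` in degree `n`. -/
def complex : ChainComplex (ModuleCat.{u} R) ℕ :=
  ChainComplex.of (fun n => ModuleCat.of R (⋀[R]^n L)) (fun n => ModuleCat.ofHom (d R L n))
    (fun n => by
      rw [← ModuleCat.ofHom_comp]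
      have h : d R L n ∘ₗ d R L (n + 1) = 0 :=
        LinearMap.ext fun w => Subtype.ext (bd_bd (R := R) (w : ExteriorAlgebra R L))
      rw [h]
      rfl)

end ChevalleyEilenberg

/-- The Chevalley-Eilenberg homology `H^CE_n(L)`. -/
def ceHomology (R : Type u) [CommRing R] (L : LieAlgCat R) (n : ℕ) : ModuleCat.{u} R :=
  (ChevalleyEilenberg.complex R L).homology n

/-! ## The example -/

/-- The ring `𝔽₃[t₁, t₂, t₃, t₄] / (t₁², t₂², t₃², t₄²)`. -/
abbrev ExampleRing : Type :=
  MvPolynomial (Fin 4) (ZMod 3) ⧸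
    Ideal.span (Set.range fun i : Fin 4 => (MvPolynomial.X i ^ 2 : MvPolynomial (Fin 4) (ZMod 3)))

/-- The class of the variable `t_i`. -/
def ExampleRing.t (i : Fin 4) : ExampleRing := Ideal.Quotient.mk _ (MvPolynomial.X i)

/-- The module with generators `e₁, e₂, e₃, e₄` and the single relation
`t₁e₁ + t₂e₂ + t₃e₃ + t₄e₄ = 0`. -/
abbrev ExampleModule : Type :=
  (Fin 4 → ExampleRing) ⧸
    Submodule.span ExampleRing
      {∑ i : Fin 4, ExampleRing.t i • (Pi.single i 1 : Fin 4 → ExampleRing)}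

/-- The free Lie algebra on the module above. -/
def exampleLie : LieAlgCat ExampleRing :=
  (freeLie ExampleRing).obj (ModuleCat.of ExampleRing ExampleModule)

end

/-!
The relative simplicial homology vanishes because a free Lie algebra `ℱ(M)` is a coalgebra over the
comonad `𝒢 = ℱ𝒰`: the morphism `σ = ℱ(η)` is a section of the counit `𝒢ℱ(M) ⟶ ℱ(M)`, and the
iterates `𝒢ⁿσ` form a contracting homotopy of the bar complex
(`ComonadBar.complex_exactAt_of_section`).

For Chevalley-Eilenberg homology put `aᵢ = tᵢeᵢ`, so that `a₀ + a₁ + a₂ + a₃ = 0` in `M`, and take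
`x = a₀ ∧ a₁ ∧ a₂ ∈ Λ³ℱ(M)`.

* `x` is a cycle. As `tᵢ² = 0`, the element `aᵢ ∧ [aᵢ, y]` vanishes for every `y` and `i`. Applied
  to `a₃ = -(a₀ + a₁ + a₂)` and `y ∈ {a₀, a₁}`, this says that the three terms
  `a₀ ∧ [a₁, a₂]`, `a₁ ∧ [a₂, a₀]`, `a₂ ∧ [a₀, a₁]` of `∂x` are all equal, so that `∂x` is a
  multiple of `3 = 0` (`ChevalleyEilenberg.bd_wedge_eq_zero`).
* `x` is not a boundary. The projection `ℱ(M) → M` kills brackets, so that its exterior cube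
  kills boundaries (`ChevalleyEilenberg.liftAlternating_bd_eq_zero`). The alternating form
  `det(r, ·, ·, ·)` on the free module with basis `e₀, e₁, e₂, e₃`, with
  `r = t₀e₀ + t₁e₁ + t₂e₂ + t₃e₃`, descends to `M`, and its value at `(a₀, a₁, a₂)` is
  `± t₀t₁t₂t₃ ≠ 0`.
-/

/-! ### The bar complex of an object with a section of the counit -/

namespace ComonadBar

variable {C : Type*} [Category C] (G : Comonad C) {X : C} (σ : X ⟶ (G : C ⥤ C).obj X)

/-- The extra degeneracy `Gⁿσ : Gⁿ X ⟶ Gⁿ⁺¹ X`. -/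
def extraDegeneracy : (n : ℕ) → (pow G X n ⟶ pow G X (n + 1))
  | 0 => σ
  | n + 1 => (G : C ⥤ C).map (extraDegeneracy n)

theorem extraDegeneracy_face_last (hσ : σ ≫ G.ε.app X = 𝟙 X) : ∀ n : ℕ,
    extraDegeneracy G σ n ≫ face G X n (Fin.last n) = 𝟙 _
  | 0 => hσ
  | n + 1 => by
    have h := congrArg (G : C ⥤ C).map (extraDegeneracy_face_last hσ n)
    rw [Functor.map_comp, CategoryTheory.Functor.map_id] at h
    exact h

theorem extraDegeneracy_face_castSucc : ∀ (n : ℕ) (i : Fin (n + 1)),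
    extraDegeneracy G σ (n + 1) ≫ face G X (n + 1) i.castSucc =
      face G X n i ≫ extraDegeneracy G σ n := by
  intro n
  induction n with
  | zero =>
    intro i
    obtain rfl : i = 0 := Fin.fin_one_eq_zero i
    exact G.ε.naturality _
  | succ n ih =>
    intro i
    induction i using Fin.cases with
    | zero =>
      rw [Fin.castSucc_zero, face_zero, face_zero]
      exact G.ε.naturality _
    | succ i =>
      have h := congrArg (G : C ⥤ C).map (ih i)
      rw [Functor.map_comp, Functor.map_comp] at h
      exact h

variable {A : Type*} [Category A]

/-- The extra degeneracy is a contracting homotopy, up to sign. -/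
theorem map_extraDegeneracy_comp_d [Preadditive A] (Φ : C ⥤ A) (hσ : σ ≫ G.ε.app X = 𝟙 X)
    (n : ℕ) :
    Φ.map (extraDegeneracy G σ (n + 2)) ≫ d G Φ X (n + 1) =
      d G Φ X n ≫ Φ.map (extraDegeneracy G σ (n + 1)) + (-1 : ℤ) ^ (n + 2) • 𝟙 _ := by
  rw [d, d, Fin.sum_univ_castSucc, Preadditive.comp_add, Preadditive.comp_sum,
    Preadditive.sum_comp]
  congr 1
  · refine Finset.sum_congr rfl fun i _ => ?_
    rw [Preadditive.comp_zsmul, Preadditive.zsmul_comp, ← Φ.map_comp, ← Φ.map_comp,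
      extraDegeneracy_face_castSucc]
    rfl
  · rw [Preadditive.comp_zsmul, ← Φ.map_comp, extraDegeneracy_face_last G σ hσ, Φ.map_id]
    rfl

/-- The bar complex, with values in modules, is exact in positive degrees. Of a coalgebra structure
`σ` on `X`, only the counit law `σ ≫ ε = 𝟙` enters. -/
theorem complex_exactAt_of_section {R : Type*} [Ring R] (Φ : C ⥤ ModuleCat R)
    (hσ : σ ≫ G.ε.app X = 𝟙 X) (n : ℕ) : (complex G Φ X).ExactAt (n + 1) := by
  rw [HomologicalComplex.exactAt_iff' _ (n + 2) (n + 1) n (by simp) (by simp),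
    ShortComplex.moduleCat_exact_iff]
  intro (z : Φ.obj (pow G X (n + 2))) hz
  replace hz : (d G Φ X n).hom z = 0 := by
    have h : (complex G Φ X).d (n + 1) n = d G Φ X n :=
      ChainComplex.of_d (fun n => Φ.obj (pow G X (n + 1))) (d G Φ X) _
    rw [← h]; exact hz
  have key := congrArg (fun f => f.hom z) (map_extraDegeneracy_comp_d G σ Φ hσ n)
  simp only [ModuleCat.hom_comp, LinearMap.comp_apply, ModuleCat.hom_add, LinearMap.add_apply,
    hz, map_zero, zero_add] at key
  refine ⟨(-1 : ℤ) ^ (n + 2) • (Φ.map (extraDegeneracy G σ (n + 2))).hom z, ?_⟩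
  have h : (complex G Φ X).d (n + 2) (n + 1) = d G Φ X (n + 1) :=
    ChainComplex.of_d (fun n => Φ.obj (pow G X (n + 1))) (d G Φ X) _
  change ((complex G Φ X).d (n + 2) (n + 1)).hom _ = z
  rw [h]
  refine (map_zsmul (d G Φ X (n + 1)).hom _ _).trans ?_
  refine (congrArg _ key).trans ?_
  change (-1 : ℤ) ^ (n + 2) • ((-1 : ℤ) ^ (n + 2) • z) = z
  rw [smul_smul, ← mul_pow]
  simp

end ComonadBar

theorem subsingleton_relSimplicialHomology_freeLie {R : Type u} [CommRing R] (M : ModuleCat.{u} R)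
    (n : ℕ) : Subsingleton (relSimplicialHomology R ((freeLie R).obj M) (n + 2)) := by
  have h := ComonadBar.complex_exactAt_of_section (freeLieAdj R).toComonad
    ((freeLie R).map ((freeLieAdj R).unit.app M)) (LieAlgCat.ab R)
    ((freeLieAdj R).left_triangle_components M) n
  exact ModuleCat.subsingleton_of_isZero h.isZero_homology

/-! ### Cycles and boundaries of the Chevalley-Eilenberg complex -/

namespace ChevalleyEilenberg

open ExteriorAlgebra

variable {R : Type u} [CommRing R] {L : Type u} [LieRing L] [LieAlgebra R L]

/-- In characteristic three, `a ∧ b ∧ c` is a cycle as soon as `z ∧ [z, y] = 0` for `z` among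
`a`, `b`, `c`, `a + b + c`. -/
theorem bd_wedge_eq_zero (h3 : (3 : R) = 0) {a b c : L}
    (ha : ∀ y, ι R a * ι R ⁅a, y⁆ = 0) (hb : ∀ y, ι R b * ι R ⁅b, y⁆ = 0)
    (hc : ∀ y, ι R c * ι R ⁅c, y⁆ = 0)
    (habc : ∀ y, ι R (a + b + c) * ι R ⁅a + b + c, y⁆ = 0) :
    bd R L (ιMulti R 3 ![a, b, c]) = 0 := by
  have hlie : ∀ x y : L, ι R ⁅x, y⁆ = -ι R ⁅y, x⁆ := fun x y => by rw [← lie_skew, map_neg]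
  -- The brackets of two of `a`, `b`, `c` are written in terms of `[a, b]`, `[b, c]`, `[c, a]`.
  have hab := ha b
  have hac := ha c
  have hba := hb a
  have hbc := hb c
  have hca := hc a
  have hcb := hc b
  have e1 := habc a
  have e2 := habc b
  rw [hlie a c, mul_neg, neg_eq_zero] at hac
  rw [hlie b a, mul_neg, neg_eq_zero] at hba
  rw [hlie c b, mul_neg, neg_eq_zero] at hcb
  -- What is left of the last hypothesis: `b ∧ [c, a] = c ∧ [a, b]` and `c ∧ [a, b] = a ∧ [b, c]`.
  simp only [add_lie, lie_self, map_add, add_mul, mul_add, hlie b a, hlie c b, mul_neg,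
    hab, hac, hba, hbc, hca, hcb, zero_add, add_zero] at e1 e2
  have key : bd R L (ιMulti R 3 ![a, b, c]) =
      ι R c * ι R ⁅a, b⁆ + ι R b * ι R ⁅c, a⁆ + ι R a * ι R ⁅b, c⁆ := by
    have hsw : ∀ x y : L, ι R x * ι R y = -(ι R y * ι R x) := fun x y =>
      eq_neg_of_add_eq_zero_left (ι_add_mul_swap x y)
    rw [bd_ιMulti, hlie c a, hsw c, mul_neg, hsw b, hsw a]
    simp only [Fin.sum_univ_succ, ιMulti_succ_apply, Fin.succAbove]
    simp [Odd.neg_one_pow (by decide : Odd 3)]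
  have h : ι R c * ι R ⁅a, b⁆ + ι R b * ι R ⁅c, a⁆ + ι R a * ι R ⁅b, c⁆ =
      (3 : R) • (ι R c * ι R ⁅a, b⁆) := by
    rw [neg_add_eq_zero] at e1
    rw [← sub_eq_add_neg, sub_eq_zero] at e2
    rw [← e1, ← e2]
    module
  rw [key, h, h3, zero_smul]

/-- A linear map on `Λⁿ⁺¹ L` that comes from an alternating map on a module `N`, by way of a linear
map `L → N` that kills brackets, vanishes on the boundaries. -/
theorem liftAlternating_bd_eq_zero {N P : Type*} [AddCommGroup N] [Module R N]
    [AddCommGroup P] [Module R P] (p : L →ₗ[R] N) (hp : ∀ x y : L, p ⁅x, y⁆ = 0) {n : ℕ}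
    (φ : N [⋀^Fin (n + 1)]→ₗ[R] P) {w : ExteriorAlgebra R L} (hw : w ∈ ⋀[R]^(n + 2) L) :
    liftAlternating (R := R) (Pi.single (n + 1) (φ.compLinearMap p)) (bd R L w) = 0 := by
  rw [← ιMulti_span_fixedDegree] at hw
  induction hw using Submodule.span_induction with
  | zero => rw [map_zero, map_zero]
  | add x y _ _ hx hy => rw [map_add, map_add, hx, hy, add_zero]
  | smul r x _ hx => rw [map_smul, map_smul, hx, smul_zero]
  | mem x hx =>
    obtain ⟨v, rfl⟩ := hx
    rw [bd_ιMulti, map_sum]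
    refine Finset.sum_eq_zero fun i _ => ?_
    rw [map_sum]
    refine Finset.sum_eq_zero fun j _ => ?_
    split_ifs
    · have h (y : L) (v : Fin n → L) :
          ι R y * ιMulti R n v = ιMulti R (n + 1) (Matrix.vecCons y v) := by
        rw [ιMulti_succ_apply]; simp
      rw [map_smul, h, liftAlternating_apply_ιMulti, Pi.single_eq_same,
        AlternatingMap.compLinearMap_apply, AlternatingMap.map_coord_zero _ 0, smul_zero]
      exact hp _ _
    · exact map_zero _

/-- A cycle in `Λⁿ⁺¹ L` on which some alternating map that factors through an abelian quotient of
`L` does not vanish represents a nonzero homology class. -/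
theorem nontrivial_homology {N P : Type*} [AddCommGroup N] [Module R N]
    [AddCommGroup P] [Module R P] (p : L →ₗ[R] N) (hp : ∀ x y : L, p ⁅x, y⁆ = 0) {n : ℕ}
    (φ : N [⋀^Fin (n + 1)]→ₗ[R] P) (v : Fin (n + 1) → L)
    (hv : bd R L (ιMulti R (n + 1) v) = 0) (hφ : φ (p ∘ v) ≠ 0) :
    Nontrivial ((complex R L).homology (n + 1)) := by
  by_contra hn
  rw [not_nontrivial_iff_subsingleton] at hn
  have hex : (complex R L).ExactAt (n + 1) :=
    (HomologicalComplex.exactAt_iff_isZero_homology _ _).2 (ModuleCat.isZero_of_subsingleton _)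
  rw [HomologicalComplex.exactAt_iff' _ (n + 2) (n + 1) n (by simp) (by simp),
    ShortComplex.moduleCat_exact_iff] at hex
  have h1 : (complex R L).d (n + 1) n = ModuleCat.ofHom (d R L n) :=
    ChainComplex.of_d (fun n => ModuleCat.of R (⋀[R]^n L)) (fun n => ModuleCat.ofHom (d R L n)) _
  have h2 : (complex R L).d (n + 2) (n + 1) = ModuleCat.ofHom (d R L (n + 1)) :=
    ChainComplex.of_d (fun n => ModuleCat.of R (⋀[R]^n L)) (fun n => ModuleCat.ofHom (d R L n)) _
  obtain ⟨w, hw⟩ := hex (exteriorPower.ιMulti R (n + 1) v) (by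
    change ((complex R L).d (n + 1) n).hom _ = 0
    rw [h1]
    exact Subtype.ext hv)
  change ((complex R L).d (n + 2) (n + 1)).hom _ = _ at hw
  rw [h2] at hw
  have hw' : bd R L (w : ⋀[R]^(n + 2) L).1 = ιMulti R (n + 1) v := congrArg Subtype.val hw
  have h := liftAlternating_bd_eq_zero p hp φ (w : ⋀[R]^(n + 2) L).2
  rw [hw', liftAlternating_apply_ιMulti, Pi.single_eq_same] at h
  exact hφ h

end ChevalleyEilenberg

namespace ModuleFreeLie

/-- The projection of the free Lie algebra onto its generators: it extends the identity of `M`,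
for `M` with the zero bracket. -/
theorem exists_projection (R : Type u) [CommRing R] (M : Type u) [AddCommGroup M] [Module R M] :
    ∃ p : ModuleFreeLie R M →ₗ[R] M, (∀ x, p (of R M x) = x) ∧
      ∀ x y : ModuleFreeLie R M, p ⁅x, y⁆ = 0 := by
  let _ : LieRing M :=
    { bracket := fun _ _ => 0
      add_lie := fun _ _ _ => (add_zero 0).symm
      lie_add := fun _ _ _ => (add_zero 0).symm
      lie_self := fun _ => rfl
      leibniz_lie := fun _ _ _ => (add_zero 0).symm }
  let _ : LieAlgebra R M := { lie_smul := fun r _ _ => (smul_zero r).symm }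
  exact ⟨(lift R LinearMap.id : ModuleFreeLie R M →ₗ⁅R⁆ M), fun x => lift_of R LinearMap.id x,
    fun x y => LieHom.map_lie (lift R LinearMap.id : ModuleFreeLie R M →ₗ⁅R⁆ M) x y⟩

end ModuleFreeLie

/-! ### Alternating maps on a quotient module -/

/-- An alternating map on `V` that vanishes as soon as one argument is in `N` descends to
`V ⧸ N`. -/
theorem AlternatingMap.exists_descend_quotient {R V P ι : Type*} [CommRing R] [AddCommGroup V]
    [Module R V] [AddCommGroup P] [Module R P] [Fintype ι] (f : V [⋀^ι]→ₗ[R] P)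
    (N : Submodule R V) (hf : ∀ v i, v i ∈ N → f v = 0) :
    ∃ g : (V ⧸ N) [⋀^ι]→ₗ[R] P, ∀ v : ι → V, g (fun i => Submodule.Quotient.mk (v i)) = f v := by
  classical
  have hcongr (u v : ι → V) (huv : ∀ i, u i - v i ∈ N) : f u = f v := by
    -- The arguments are exchanged one at a time.
    have h (s : Finset ι) : f (s.piecewise u v) = f v := by
      induction s using Finset.induction_on with
      | empty => rw [Finset.piecewise_empty]
      | insert i s hi ih =>
        rw [Finset.piecewise_insert, ← ih, ← sub_eq_zero]
        have e : s.piecewise u v = Function.update (s.piecewise u v) i (v i) := by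
          rw [← Finset.piecewise_eq_of_notMem s u v hi, Function.update_eq_self]
        nth_rw 2 [e]
        rw [← AlternatingMap.map_update_sub]
        exact hf _ i (by rw [Function.update_self]; exact huv i)
    simpa using h Finset.univ
  have hout (x : V ⧸ N) : Submodule.Quotient.mk x.out = x := Quotient.out_eq' x
  have hupd [DecidableEq ι] (m : ι → V ⧸ N) (i : ι) (x : V ⧸ N) (y : V)
      (hy : Submodule.Quotient.mk y = x) : f (fun j => (Function.update m i x j).out) =
        f (Function.update (fun j => (m j).out) i y) := by
    refine hcongr _ _ fun j => ?_
    rw [← Submodule.Quotient.eq, hout]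
    rcases eq_or_ne j i with rfl | hj
    · rw [Function.update_self, Function.update_self, hy]
    · rw [Function.update_of_ne hj, Function.update_of_ne hj, hout]
  refine ⟨
    { toFun := fun v => f fun i => (v i).out
      map_update_add' := ?_
      map_update_smul' := ?_
      map_eq_zero_of_eq' := ?_ }, ?_⟩
  · intro _ m i x y
    rw [hupd m i (x + y) (x.out + y.out) (by rw [Submodule.Quotient.mk_add, hout, hout]),
      hupd m i x _ (hout x), hupd m i y _ (hout y), AlternatingMap.map_update_add]
  · intro _ m i c x
    rw [hupd m i (c • x) (c • x.out) (by rw [Submodule.Quotient.mk_smul, hout]),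
      hupd m i x _ (hout x), AlternatingMap.map_update_smul]
  · intro v i j hv hij
    exact f.map_eq_zero_of_eq _ (congrArg Quotient.out hv) hij
  · intro v
    refine hcongr _ _ fun i => ?_
    rw [← Submodule.Quotient.eq]
    exact hout _

/-! ### Modules with four generators and one relation -/

section OneRelation

variable {R : Type u} [CommRing R] (t : Fin 4 → R)

theorem sum_smul_single : ∑ i : Fin 4, t i • (Pi.single i 1 : Fin 4 → R) = t := by
  ext j
  simp [Finset.sum_apply, Pi.single_apply]

theorem detRowAlternating_vecCons_single :
    Matrix.detRowAlternating (Matrix.vecCons t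
      fun i : Fin 3 => (Pi.single i.castSucc 1 : Fin 4 → R)) = -t 3 := by
  change Matrix.det (Matrix.of (Matrix.vecCons t
      fun i : Fin 3 => (Pi.single i.castSucc 1 : Fin 4 → R))) = -t 3
  simp [Matrix.det_succ_row_zero, Fin.sum_univ_succ, Fin.succAbove, Pi.single_apply,
    Odd.neg_one_pow (by decide : Odd 3)]

theorem detRowAlternating_vecCons_eq_zero (v : Fin 3 → Fin 4 → R) (i : Fin 3) (c : R)
    (hv : v i = c • t) : Matrix.detRowAlternating (Matrix.vecCons t v) = 0 := by
  have h : Matrix.vecCons t v = Function.update (Matrix.vecCons t v) i.succ (c • t) := by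
    rw [← hv]
    exact (Function.update_eq_self i.succ (Matrix.vecCons t v)).symm
  rw [h, AlternatingMap.map_update_smul]
  -- Once `c` is pulled out, the row `i.succ` is a copy of the row `0`.
  have h' := AlternatingMap.map_update_self (Matrix.detRowAlternating (n := Fin 4) (R := R))
    (Matrix.vecCons t v) (Fin.succ_ne_zero i)
  rw [Matrix.cons_val_zero] at h'
  rw [h', smul_zero]

/-- The form `det(t, ·, ·, ·)`, where `t = ∑ tᵢeᵢ` is the relation, descends to the quotient. -/
theorem exists_alternatingMap :
    ∃ φ : ((Fin 4 → R) ⧸ Submodule.span R {∑ i : Fin 4, t i • (Pi.single i 1 : Fin 4 → R)})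
        [⋀^Fin 3]→ₗ[R] R,
      φ (fun i => Submodule.Quotient.mk (Pi.single i.castSucc 1)) = -t 3 := by
  have hf (v : Fin 3 → Fin 4 → R) (i : Fin 3)
      (hv : v i ∈ Submodule.span R {∑ i : Fin 4, t i • (Pi.single i 1 : Fin 4 → R)}) :
      (Matrix.detRowAlternating (n := Fin 4) (R := R)).curryLeft t v = 0 := by
    rw [sum_smul_single, Submodule.mem_span_singleton] at hv
    obtain ⟨c, hc⟩ := hv
    exact detRowAlternating_vecCons_eq_zero t v i c hc.symm
  obtain ⟨φ, hφ⟩ := AlternatingMap.exists_descend_quotient _ _ hf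
  exact ⟨φ, (hφ _).trans (detRowAlternating_vecCons_single t)⟩

/-- With `eᵢ` the generators and `aᵢ = tᵢeᵢ`, the class of `a₀ ∧ a₁ ∧ a₂` does not vanish. The
factor `t 3` of the condition `hne` is the value of `det(t, ·, ·, ·)` at `(e₀, e₁, e₂)`, up to sign. -/
theorem nontrivial_ceHomology_freeLie (h3 : (3 : R) = 0) (ht : ∀ i, t i * t i = 0)
    (hne : t 0 * t 1 * t 2 * t 3 ≠ 0) :
    Nontrivial (ceHomology R ((freeLie R).obj (ModuleCat.of R ((Fin 4 → R) ⧸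
      Submodule.span R {∑ i : Fin 4, t i • (Pi.single i 1 : Fin 4 → R)}))) 3) := by
  obtain ⟨φ, hφ⟩ := exists_alternatingMap t
  let N := Submodule.span R {∑ i : Fin 4, t i • (Pi.single i 1 : Fin 4 → R)}
  let M := (Fin 4 → R) ⧸ N
  let e (i : Fin 4) : M := Submodule.Quotient.mk (Pi.single i 1)
  have he : ∑ i, t i • e i = 0 := by
    have h : ∑ i, t i • e i = N.mkQ (∑ i : Fin 4, t i • (Pi.single i 1 : Fin 4 → R)) := by
      rw [map_sum]
      rfl
    rw [h, Submodule.mkQ_apply, Submodule.Quotient.mk_eq_zero]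
    exact Submodule.mem_span_singleton_self _
  obtain ⟨p, hp, hp'⟩ := ModuleFreeLie.exists_projection R M
  let a (i : Fin 4) : ModuleFreeLie R M := ModuleFreeLie.of R M (t i • e i)
  have ha (i : Fin 4) (y : ModuleFreeLie R M) :
      ExteriorAlgebra.ι R (a i) * ExteriorAlgebra.ι R ⁅a i, y⁆ = 0 := by
    have h : a i = t i • ModuleFreeLie.of R M (e i) := map_smul _ _ _
    rw [h, smul_lie, map_smul, map_smul, smul_mul_smul_comm, ht, zero_smul]
  have hsum : a 0 + a 1 + a 2 = -a 3 := by
    rw [eq_neg_iff_add_eq_zero]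
    simp only [a, ← map_add]
    rw [← Fin.sum_univ_four (fun i => t i • e i), he, map_zero]
  refine ChevalleyEilenberg.nontrivial_homology p hp' φ ![a 0, a 1, a 2]
    (ChevalleyEilenberg.bd_wedge_eq_zero h3 (ha 0) (ha 1) (ha 2) ?_) ?_
  · intro y
    rw [hsum, neg_lie, map_neg, map_neg, neg_mul_neg, ha]
  · have h : p ∘ ![a 0, a 1, a 2] = fun i : Fin 3 => t i.castSucc • e i.castSucc := by
      ext i
      fin_cases i <;> exact hp _
    have hv := φ.map_smul_univ (fun i => t i.castSucc) fun i => e i.castSucc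
    rw [h, hv, hφ, smul_neg, smul_eq_mul, neg_ne_zero, Fin.prod_univ_three]
    exact hne

end OneRelation

/-! ### The example -/

namespace ExampleRing

theorem t_mul_self (i : Fin 4) : t i * t i = 0 := by
  rw [t, ← map_mul, Ideal.Quotient.eq_zero_iff_mem, ← pow_two]
  exact Ideal.subset_span ⟨i, rfl⟩

theorem three_eq_zero : (3 : ExampleRing) = 0 := by
  have h : ((3 : ℕ) : ZMod 3) = 0 := CharP.cast_eq_zero _ _
  have h' := congrArg (algebraMap (ZMod 3) ExampleRing) h
  rwa [map_natCast, map_zero] at h'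

/-- The product of the variables is not in the monomial ideal `(t₀², t₁², t₂², t₃²)`. -/
theorem prod_t_ne_zero : t 0 * t 1 * t 2 * t 3 ≠ 0 := by
  have hX (i : Fin 4) (k : ℕ) : (MvPolynomial.X i ^ k : MvPolynomial (Fin 4) (ZMod 3)) =
      MvPolynomial.monomial (Finsupp.single i k) 1 := MvPolynomial.X_pow_eq_monomial
  let m : Fin 4 →₀ ℕ := ∑ i, Finsupp.single i 1
  have hm : (∏ i : Fin 4, MvPolynomial.X i : MvPolynomial (Fin 4) (ZMod 3)) =
      MvPolynomial.monomial m 1 := by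
    rw [MvPolynomial.monomial_sum_one]
    rfl
  rw [← Fin.prod_univ_four t]
  simp only [t]
  rw [← map_prod, hm, Ne, Ideal.Quotient.eq_zero_iff_mem]
  simp only [hX]
  have hr : (Set.range fun i : Fin 4 => MvPolynomial.monomial (Finsupp.single i 2) (1 : ZMod 3)) =
      (fun s => MvPolynomial.monomial s (1 : ZMod 3)) '' Set.range fun i => Finsupp.single i 2 := by
    rw [← Set.range_comp]
    rfl
  rw [hr, MvPolynomial.mem_ideal_span_monomial_image]
  intro h
  obtain ⟨_, ⟨i, rfl⟩, hi⟩ := h m (by simp)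
  have := hi i
  simp [m, Finsupp.finsetSum_apply, Finsupp.single_apply] at this

end ExampleRing

theorem mainTheorem12 :
    Nontrivial (ceHomology ExampleRing exampleLie 3) ∧
      Subsingleton (relSimplicialHomology ExampleRing exampleLie 3) :=
  ⟨nontrivial_ceHomology_freeLie ExampleRing.t ExampleRing.three_eq_zero ExampleRing.t_mul_self
    ExampleRing.prod_t_ne_zero, subsingleton_relSimplicialHomology_freeLie _ 1⟩
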